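/- Let $\Bbbk$ be an algebraically closed field, $A$ a finite-dimensional (associative, unital) $\Bbbk$-algebra, and $\mathrm{mod}\,A$ the category of finite-dimensional left $A$-modules. A brick set in $\mathrm{mod}\,A$ is a finite family $\phi=\{X_1,\dots,X_n\}$ ($n\ge 1$) of modules with $\mathrm{Hom}_A(X_i,X_i)=\Bbbk$ for all $i$ and $\dim_\Bbbk\mathrm{Hom}_A(X_i,X_j)=\delta_{ij}$ for all $i,j$. Let $\tau=D\,\mathrm{Tr}$ be the Auslander–Reiten translate: if $P_1\to P_0\to M\to 0$ is a minimal projective presentation of $M$, then $\mathrm{Tr}\,M$ is the cokernel of $\mathrm{Hom}_A(P_0,A)\to\mathrm{Hom}_A(P_1,A)$, a right $A$-module, and $\tau M=\mathrm{Hom}_\Bbbk(\mathrm{Tr}\,M,\Bbbk)$. With $\rho$ the spectral radius of a square matrix and the suprema taken in $[0,\infty]$ (with $\sup\emptyset=0$) over all brick sets $\phi=\{X_1,\dots,X_n\}$ in $\mathrm{mod}\,A$ and all $n\ge 1$, put $$\mathrm{fpd}_A(E^1)=\sup_{\phi}\ \rho\Big(\big(\dim_\Bbbk\mathrm{Ext}^1_A(X_i,X_j)\big)_{i,j=1}^n\Big),\qquad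 \mathrm{fpd}_A(\tau)=\sup_{\phi}\ \rho\Big(\big(\dim_\Bbbk\mathrm{Hom}_A(X_i,\tau X_j)\big)_{i,j=1}^n\Big).$$ Then $$\mathrm{fpd}_A(E^1)\le \mathrm{fpd}_A(\tau).$$ -/

import Mathlib

open CategoryTheory

universe w v u t

noncomputable section

namespace FrobeniusPerron

/-! ### Spectral radius of a matrix over the extended real numbers -/

/-- The real matrix obtained from a matrix `a` over the extended reals by replacing every entry
`∞` by `x i j` and every entry `-∞` by `-x i j`, viewed as a complex matrix. -/
def fillInfinite {n : ℕ} (a : Matrix (Fin n) (Fin n) EReal) (x : Matrix (Fin n) (Fin n) ℝ) :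
    Matrix (Fin n) (Fin n) ℂ :=
  Matrix.of fun i j =>
    (((if a i j = ⊤ then x i j else if a i j = ⊥ then -x i j else (a i j).toReal) : ℝ) : ℂ)

/-- The spectral radius of a matrix over the extended reals: the lower limit, as all `x i j` tend
to infinity, of the largest modulus of a complex eigenvalue of `fillInfinite a x`.  If all entries
are finite this is the usual spectral radius. -/
def extSpectralRadius {n : ℕ} (a : Matrix (Fin n) (Fin n) EReal) : ENNReal :=
  Filter.liminf (fun x : Fin n → Fin n → ℝ => spectralRadius ℂ (fillInfinite a (Matrix.of x)))
    Filter.atTop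

/-! ### Brick sets and Frobenius-Perron dimension of an assignment -/

section Category

variable (k : Type t) [Field k] (C : Type u) [Category.{v} C]

/-- The dimension of a vector space, as an extended natural number in the extended reals. -/
def extDim (V : Type w) [AddCommGroup V] [Module k V] : EReal :=
  (((Module.rank k V).toENat : ENNReal) : EReal)

/-- An assignment sending each `n`-tuple of objects to an `n × n` matrix of vector spaces, such
that a subfamily is sent to the corresponding principal submatrix. -/
structure Assignment where
  /-- the matrix of vector spaces attached to a finite family of objects -/
  toFun : ∀ {n : ℕ}, (Fin n → C) → Matrix (Fin n) (Fin n) (ModuleCat.{w} k)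
  toFun_comp : ∀ {m n : ℕ} (f : Fin m ↪ Fin n) (X : Fin n → C),
    toFun (X ∘ f) = (toFun X).submatrix f f

variable {k C} in
/-- The adjacency matrix of a finite family of objects with respect to an assignment. -/
def Assignment.adjacency (ζ : Assignment.{w} k C) {n : ℕ} (X : Fin n → C) :
    Matrix (Fin n) (Fin n) EReal :=
  Matrix.of fun i j => extDim k (ζ.toFun X i j)

variable [Preadditive C] [Linear k C]

variable {C} in
/-- A brick is an object whose endomorphism algebra is the base field. -/
def IsBrick (M : C) : Prop :=
  Function.Bijective fun c : k => c • 𝟙 M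

variable {C} in
/-- A finite family of bricks is a brick set if `dim Hom(X i, X j) = δ i j`. In particular, the
objects are then nonzero and pairwise non-isomorphic. -/
def IsBrickSet {n : ℕ} (X : Fin n → C) : Prop :=
  (∀ i, IsBrick k (X i)) ∧ ∀ i j, extDim k (X i ⟶ X j) = if i = j then 1 else 0

variable {k C} in
/-- The `n`-th Frobenius-Perron dimension of an assignment. -/
def fpdNth (ζ : Assignment.{w} k C) (n : ℕ) : ENNReal :=
  ⨆ (X : Fin n → C) (_ : IsBrickSet k X), extSpectralRadius (ζ.adjacency X)

variable {k C} in
/-- The Frobenius-Perron dimension of an assignment. -/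
def fpd (ζ : Assignment.{w} k C) : ENNReal :=
  ⨆ (n : ℕ) (_ : 1 ≤ n), fpdNth ζ n

variable {C} in
/-- The assignment `(X i) ↦ (Hom(X i, σ (X j)))` attached to an operation `σ` on objects. -/
def homAssignment (σ : C → C) : Assignment.{v} k C where
  toFun X := Matrix.of fun i j => ModuleCat.of k (X i ⟶ σ (X j))
  toFun_comp _ _ := rfl

end Category

/-- The assignment `(X i) ↦ (Ext^m(X i, X j))` on a `k`-linear abelian category; `Ext^0` is
`Hom`. -/
def extAssignment (k : Type t) [Field k] (C : Type u) [Category.{v} C] [Abelian C] [Linear k C]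
    (m : ℕ) : Assignment.{max u v} k C :=
  haveI : HasExt.{max u v} C := HasExt.standard C
  { toFun := fun X => Matrix.of fun i j => ModuleCat.of k (Abelian.Ext.{max u v} (X i) (X j) m)
    toFun_comp := fun _ _ => rfl }

/-! ### Projective covers -/

section ProjectiveCover

variable {A : Type u} [Ring A]

/-- A projective cover: a surjection from a projective module with superfluous kernel. -/
structure IsProjectiveCover {P : Type v} {M : Type w} [AddCommGroup P] [Module A P]
    [AddCommGroup M] [Module A M] (π : P →ₗ[A] M) : Prop where
  projective : Module.Projective A P
  surjective : Function.Surjective π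
  superfluous : ∀ N : Submodule A P, N ⊔ LinearMap.ker π = ⊤ → N = ⊤

/-- Over an artinian ring, every finitely generated module has a finitely generated projective
cover. -/
theorem exists_isProjectiveCover [IsArtinianRing A] (M : Type v) [AddCommGroup M] [Module A M]
    [Module.Finite A M] :
    ∃ (P : FGModuleCat.{u} A) (π : P →ₗ[A] M), IsProjectiveCover π := by
  obtain ⟨n, p, hp⟩ := Module.Finite.exists_fin' A M
  let S : Set (Submodule A (Fin n → A)) :=
    {N | Module.Projective A N ∧ Function.Surjective (p ∘ₗ N.subtype)}
  have hS : S.Nonempty := by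
    refine ⟨⊤, Module.Projective.of_equiv (Submodule.topEquiv (R := A) (M := Fin n → A)).symm, ?_⟩
    intro m
    obtain ⟨x, rfl⟩ := hp m
    exact ⟨⟨x, trivial⟩, rfl⟩
  obtain ⟨N, ⟨hNp, hNs⟩, hmin⟩ := (wellFounded_lt (α := Submodule A (Fin n → A))).has_min S hS
  have hNf : Module.Finite A N := inferInstance
  set π : N →ₗ[A] M := p ∘ₗ N.subtype with hπ
  refine ⟨FGModuleCat.of A N, π, hNp, hNs, ?_⟩
  intro L hL
  change Submodule A N at L
  -- lift `π` through the restriction of `π` to `L`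
  have hLs : Function.Surjective (π ∘ₗ L.subtype) := by
    intro m
    obtain ⟨x, rfl⟩ := hNs m
    have hx : x ∈ L ⊔ LinearMap.ker π := by rw [hL]; trivial
    obtain ⟨y, hy, z, hz, rfl⟩ := Submodule.mem_sup.1 hx
    refine ⟨⟨y, hy⟩, ?_⟩
    have : π z = 0 := hz
    simp [this]
  obtain ⟨g, hg⟩ := Module.projective_lifting_property (π ∘ₗ L.subtype) π hLs
  let q : N →ₗ[A] N := L.subtype ∘ₗ g
  have hq : ∀ x, π (q x) = π x := fun x => LinearMap.congr_fun hg x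
  have hqn : ∀ (r : ℕ) x, π ((q ^ r) x) = π x := by
    intro r
    induction r with
    | zero => intro x; simp
    | succ r ih => intro x; rw [pow_succ', Module.End.mul_apply, hq, ih]
  obtain ⟨r, hr⟩ := Filter.eventually_atTop.1 (LinearMap.eventually_isCompl_ker_pow_range_pow q)
  have hc := hr (r + 1) (by omega)
  let R : Submodule A N := LinearMap.range (q ^ (r + 1))
  have hRL : R ≤ L := by
    rintro _ ⟨x, rfl⟩
    rw [pow_succ', Module.End.mul_apply]
    exact (g _).2
  have hRp : Module.Projective A R :=
    Module.Projective.of_split R.subtype (Submodule.projectionOnto R _ hc.symm)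
      (LinearMap.ext fun x => Submodule.projectionOnto_apply_left hc.symm x)
  have hRN : R.map N.subtype ∈ S := by
    refine ⟨Module.Projective.of_equiv
      (Submodule.equivMapOfInjective N.subtype N.injective_subtype R), ?_⟩
    intro m
    obtain ⟨x, rfl⟩ := hNs m
    exact ⟨⟨_, Submodule.mem_map_of_mem ⟨x, rfl⟩⟩, hqn (r + 1) x⟩
  have hle : R.map N.subtype ≤ N := Submodule.map_subtype_le N R
  have heq : R.map N.subtype = N := by
    by_contra h
    exact hmin _ hRN (lt_of_le_of_ne hle h)
  have hR : R = ⊤ := by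
    apply Submodule.map_injective_of_injective N.injective_subtype
    rw [heq, Submodule.map_top, Submodule.range_subtype]
  exact top_le_iff.1 (hR ▸ hRL)

variable [IsArtinianRing A]

/-- A chosen projective cover `P(M)` of a finitely generated module `M`. -/
def projCover (M : FGModuleCat.{u} A) : FGModuleCat.{u} A :=
  (exists_isProjectiveCover (A := A) M).choose

/-- The projection `P(M) → M`. -/
def projCoverMap (M : FGModuleCat.{u} A) : projCover M →ₗ[A] M :=
  (exists_isProjectiveCover (A := A) M).choose_spec.choose

theorem isProjectiveCover_projCoverMap (M : FGModuleCat.{u} A) :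
    IsProjectiveCover (projCoverMap M) :=
  (exists_isProjectiveCover (A := A) M).choose_spec.choose_spec

/-- The first syzygy: the kernel of the projective cover. -/
def syzygy (M : FGModuleCat.{u} A) : FGModuleCat.{u} A :=
  FGModuleCat.of A (LinearMap.ker (projCoverMap M))

/-- The map `d : P₁ → P₀` of the minimal projective presentation `P₁ → P₀ → M → 0`, where
`P₀ = P(M)` and `P₁` is the projective cover of the kernel of `P₀ → M`. -/
def minPresentationMap (M : FGModuleCat.{u} A) : projCover (syzygy M) →ₗ[A] projCover M :=
  (LinearMap.ker (projCoverMap M)).subtype ∘ₗ projCoverMap (syzygy M)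

end ProjectiveCover

/-! ### The Auslander-Reiten translate -/

section Translate

variable (A : Type u) [Ring A]

/-- The map `Hom_A(d, A) : Hom_A(Q, A) → Hom_A(P, A)` of right `A`-modules. Right `A`-modules are
modules over the opposite ring; here `(f a) x = (f x) a`. -/
def dualMapRight {P Q : Type u} [AddCommGroup P] [Module A P] [AddCommGroup Q] [Module A Q]
    (d : P →ₗ[A] Q) : (Q →ₗ[A] A) →ₗ[Aᵐᵒᵖ] (P →ₗ[A] A) where
  toFun f := f ∘ₗ d
  map_add' _ _ := rfl
  map_smul' _ _ := rfl

variable {A} in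
/-- The transpose of `M`: the right module `coker (Hom_A(P₀, A) → Hom_A(P₁, A))`, for the minimal
projective presentation `P₁ → P₀ → M → 0`. -/
abbrev Transpose [IsArtinianRing A] (M : FGModuleCat.{u} A) : Type u :=
  (projCover (syzygy M) →ₗ[A] A) ⧸ LinearMap.range (dualMapRight A (minPresentationMap M))

variable (k : Type u) [Field k] [Algebra k A]

/-- The `k`-dual `D X = Hom_k(X, k)` of a right `A`-module `X`. -/
def RightDual (X : Type u) [AddCommGroup X] [Module k X] : Type u :=
  Module.Dual k X

namespace RightDual

variable (X : Type u) [AddCommGroup X] [Module k X]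

instance : AddCommGroup (RightDual k X) := inferInstanceAs (AddCommGroup (Module.Dual k X))

instance : Module k (RightDual k X) := inferInstanceAs (Module k (Module.Dual k X))

/-- The tautological identification of `D X` with the space of `k`-linear forms on `X`. -/
def toDual : RightDual k X ≃ₗ[k] Module.Dual k X := LinearEquiv.refl k (Module.Dual k X)

instance [Module.Finite k X] : Module.Finite k (RightDual k X) :=
  Module.Finite.equiv (toDual k X).symm

variable [Module Aᵐᵒᵖ X] [IsScalarTower k Aᵐᵒᵖ X]

instance : SMul A (RightDual k X) where
  smul a f := (toDual k X).symm
    (toDual k X f ∘ₗ Module.toModuleEnd k (S := Aᵐᵒᵖ) X (MulOpposite.op a))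

theorem toDual_smul (a : A) (f : RightDual k X) (x : X) :
    toDual k X (a • f) x = toDual k X f (MulOpposite.op a • x) := rfl

theorem ext_toDual {f g : RightDual k X} (h : ∀ x, toDual k X f x = toDual k X g x) : f = g :=
  (toDual k X).injective (LinearMap.ext h)

/-- The left `A`-module structure on `D X`, given by `(a f) x = f (x a)`. -/
instance : Module A (RightDual k X) where
  one_smul f := ext_toDual k X fun x => by simp [toDual_smul]
  mul_smul a b f := ext_toDual k X fun x => by simp [toDual_smul, mul_smul]
  smul_zero a := ext_toDual k X fun x => by simp [toDual_smul]
  smul_add a f g := ext_toDual k X fun x => by simp [toDual_smul]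
  add_smul a b f := ext_toDual k X fun x => by simp [toDual_smul, add_smul]
  zero_smul f := ext_toDual k X fun x => by simp [toDual_smul]

instance : IsScalarTower k A (RightDual k X) where
  smul_assoc c a f := ext_toDual k X fun x => by
    simp [toDual_smul]

theorem finite [Module.Finite k X] : Module.Finite A (RightDual k X) :=
  Module.Finite.of_restrictScalars_finite k A _

end RightDual

theorem finite_hom_self [Module.Finite k A] (P : Type u) [AddCommGroup P] [Module A P]
    [Module.Finite A P] : Module.Finite k (P →ₗ[A] A) := by
  obtain ⟨n, p, hp⟩ := Module.Finite.exists_fin' A P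
  let φ : (P →ₗ[A] A) →ₗ[k] (Fin n → A) :=
    { toFun := fun f i => f (p (Pi.single i 1))
      map_add' := fun _ _ => rfl
      map_smul' := fun _ _ => rfl }
  refine Module.Finite.of_injective φ fun f g h => ?_
  have : f ∘ₗ p = g ∘ₗ p := by
    refine LinearMap.pi_ext' fun i => LinearMap.ext_ring ?_
    exact congrFun h i
  exact LinearMap.ext fun x => by
    obtain ⟨y, rfl⟩ := hp x
    exact LinearMap.congr_fun this y

/-- The Auslander-Reiten translate `τ M = D Tr M` of a finitely generated module over a
finite-dimensional algebra. -/
def arTranslate [IsArtinianRing A] [Module.Finite k A] (M : FGModuleCat.{u} A) :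
    FGModuleCat.{u} A :=
  haveI : Module.Finite k (projCover (syzygy M) →ₗ[A] A) := finite_hom_self A k _
  haveI : Module.Finite A (RightDual k (Transpose M)) := RightDual.finite A k _
  FGModuleCat.of A (RightDual k (Transpose M))

end Translate

/-! ### Frobenius-Perron dimensions of a finite-dimensional algebra

The category `mod A` of finite-dimensional left modules is `FGModuleCat A`. -/

section Algebra

variable (k : Type u) [Field k] (A : Type u) [Ring A] [Algebra k A] [FiniteDimensional k A]

/-- `fpd_A(E^m)`, the Frobenius-Perron dimension of `Ext^m` on `mod A`. -/
def fpdExt (m : ℕ) : ENNReal :=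
  haveI : IsNoetherianRing A := isNoetherian_of_tower k inferInstance
  fpd (extAssignment k (FGModuleCat.{u} A) m)

/-- `fpd_A(τ)`, the Frobenius-Perron dimension of the Auslander-Reiten translate of `mod A`. -/
def fpdTau : ENNReal :=
  haveI : IsArtinianRing A := isArtinian_of_tower k inferInstance
  fpd (homAssignment k (arTranslate A k))

end Algebra

end FrobeniusPerron

end

/-! The theorem follows from one half of the Auslander–Reiten formula, `finrank_ext_one_le`: `dim
Ext¹(M, Y) ≤ dim Hom(Y, τM)`. Take the minimal presentation `P₁ → P₀ → M → 0`. Since `P₀` is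
projective, `Ext¹(M, Y)` is a quotient of `Hom(ΩM, Y)` by a subspace containing the image of
`Hom(P₀, Y)`, and `Hom(ΩM, Y)` embeds into `Hom(P₁, Y)`. So its dimension is at most that of the
space of linear forms `l` on `Hom(P₁, Y)` killing the image of `Hom(P₀, Y)`. Each such `l` yields `Y
→ D Tr M`, `y ↦ (f ↦ l (f(-) y))`, and `l` is recovered from it because the maps `f(-) y` span
`Hom(P₁, Y)`.

For any family `X`, the Ext matrix is thus bounded entrywise by the transpose of the `τ` matrix. The
spectral radius is invariant under transposition and monotone on nonnegative matrices. -/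

noncomputable section

namespace FrobeniusPerron

/-! ### Spectral radii and dimension counts -/

open scoped Matrix.Norms.Operator in
/-- The spectral radius is monotone on matrices with nonnegative entries. -/
theorem spectralRadius_mono {n : ℕ} {a b : Matrix (Fin n) (Fin n) ℝ}
    (ha : ∀ i j, 0 ≤ a i j) (hab : ∀ i j, a i j ≤ b i j) :
    spectralRadius ℂ (a.map ((↑) : ℝ → ℂ)) ≤ spectralRadius ℂ (b.map ((↑) : ℝ → ℂ)) := by
  have hpow : ∀ r i j, 0 ≤ (a ^ r) i j ∧ (a ^ r) i j ≤ (b ^ r) i j := by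
    intro r
    induction r with
    | zero =>
      intro i j
      simp only [pow_zero, Matrix.one_apply, le_refl, and_true]
      split_ifs <;> norm_num
    | succ r ih =>
      intro i j
      simp only [pow_succ, Matrix.mul_apply]
      exact ⟨Finset.sum_nonneg fun l _ => mul_nonneg (ih i l).1 (ha l j),
        Finset.sum_le_sum fun l _ => mul_le_mul (ih i l).2 (hab l j) (ha l j)
          ((ih i l).1.trans (ih i l).2)⟩
  have hmap : ∀ (c : Matrix (Fin n) (Fin n) ℝ) (r : ℕ),
      c.map ((↑) : ℝ → ℂ) ^ r = (c ^ r).map ((↑) : ℝ → ℂ) := fun c r =>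
    (map_pow (Complex.ofRealHom.mapMatrix (m := Fin n)) c r).symm
  -- Gelfand's formula: it suffices to compare the norms of the powers, here in the maximal row sum
  -- norm, which is monotone in nonnegative entries.
  refine le_of_tendsto_of_tendsto'
    (spectrum.pow_nnnorm_pow_one_div_tendsto_nhds_spectralRadius _)
    (spectrum.pow_nnnorm_pow_one_div_tendsto_nhds_spectralRadius _) fun r => ?_
  refine ENNReal.rpow_le_rpow (ENNReal.coe_le_coe.2 ?_) (by positivity)
  rw [hmap, hmap, Matrix.linfty_opNNNorm_def, Matrix.linfty_opNNNorm_def]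
  refine Finset.sup_mono_fun fun i _ => Finset.sum_le_sum fun j _ => ?_
  rw [← NNReal.coe_le_coe]
  obtain ⟨h₁, h₂⟩ := hpow r i j
  simpa [abs_of_nonneg h₁, abs_of_nonneg (h₁.trans h₂)] using h₂

theorem spectralRadius_transpose {n : ℕ} (a : Matrix (Fin n) (Fin n) ℂ) :
    spectralRadius ℂ a.transpose = spectralRadius ℂ a := by
  have : spectrum ℂ a.transpose = spectrum ℂ a := by
    ext c
    rw [spectrum.mem_iff, spectrum.mem_iff, ← Matrix.isUnit_transpose, Matrix.transpose_sub,
      Matrix.transpose_transpose, Matrix.algebraMap_eq_diagonal, Matrix.diagonal_transpose]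
  rw [spectralRadius, spectralRadius, this]

/-- With all entries finite, nothing is filled in and the lower limit is that of a constant. -/
theorem extSpectralRadius_coe {n : ℕ} (a : Matrix (Fin n) (Fin n) ℝ) :
    extSpectralRadius (Matrix.of fun i j => (a i j : EReal)) =
      spectralRadius ℂ (a.map ((↑) : ℝ → ℂ)) := by
  have : ∀ x, fillInfinite (Matrix.of fun i j => (a i j : EReal)) x = a.map ((↑) : ℝ → ℂ) := by
    intro x
    ext i j
    simp [fillInfinite]
  simp only [extSpectralRadius, this]
  exact Filter.liminf_const _

theorem extDim_eq_finrank (k : Type*) [Field k] (V : Type*) [AddCommGroup V] [Module k V]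
    [Module.Finite k V] : extDim k V = ((Module.finrank k V : ℝ) : EReal) := by
  have h : Cardinal.toENat (Module.rank k V) = (Module.finrank k V : ℕ) := by
    rw [← Module.finrank_eq_rank, Cardinal.toENat_nat]
  rw [extDim, h, ENat.toENNReal_coe, ← ENNReal.coe_natCast, EReal.coe_nnreal_eq_coe_real,
    NNReal.coe_natCast]

/-- If `E` is a quotient of `H` by a subspace containing the image of `r`, and `H` embeds into `K`
by `q`, then `dim E` is at most the dimension of the space of linear forms on `K` that vanish on
the image of `q ∘ r`. -/
theorem finrank_le_of_dual {k E G H K V : Type*} [Field k] [AddCommGroup E] [Module k E]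
    [AddCommGroup G] [Module k G] [AddCommGroup H] [Module k H] [AddCommGroup K] [Module k K]
    [AddCommGroup V] [Module k V] [Module.Finite k K] [Module.Finite k V]
    (s : H →ₗ[k] E) (r : G →ₗ[k] H) (q : H →ₗ[k] K) (hs : Function.Surjective s)
    (hsr : s ∘ₗ r = 0) (hq : Function.Injective q)
    (θ : (LinearMap.range (q ∘ₗ r)).dualAnnihilator →ₗ[k] V) (hθ : Function.Injective θ) :
    Module.Finite k E ∧ Module.finrank k E ≤ Module.finrank k V := by
  have : Module.Finite k H := Module.Finite.of_injective q hq
  refine ⟨Module.Finite.of_surjective s hs, ?_⟩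
  have h₁ := LinearMap.finrank_range_add_finrank_ker s
  rw [LinearMap.range_eq_top.2 hs, finrank_top] at h₁
  have h₂ : Module.finrank k (LinearMap.range r) ≤ Module.finrank k (LinearMap.ker s) :=
    Submodule.finrank_mono (LinearMap.range_le_ker_iff.2 hsr)
  have h₃ := LinearMap.finrank_le_finrank_of_injective hq
  have h₄ := LinearMap.finrank_le_finrank_of_injective hθ
  have h₅ := Subspace.finrank_add_finrank_dualAnnihilator_eq (LinearMap.range (q ∘ₗ r))
  have h₆ : Module.finrank k (LinearMap.range (q ∘ₗ r)) = Module.finrank k (LinearMap.range r) := by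
    rw [LinearMap.range_comp]
    exact (Submodule.equivMapOfInjective q hq (LinearMap.range r)).finrank_eq.symm
  -- `dim E = dim H - dim ker s ≤ dim K - rank (q ∘ r) = dim` of the annihilator `≤ dim V`.
  omega

/-! ### Linear forms on `Hom(P, Y)` and maps into the dual of a cokernel -/

section HomToRightDual

variable {k : Type u} [Field k] {A : Type u} [Ring A] [Algebra k A]
  {P Q Y : Type u} [AddCommGroup P] [Module A P] [AddCommGroup Q] [Module A Q]
  [AddCommGroup Y] [Module A Y] [Module k Y] [IsScalarTower k A Y]

/-- For `y : Y`, the map `Hom_A(P, A) → Hom_A(P, Y)` sending `f` to `x ↦ f x • y`. -/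
def homSMulRight (k : Type u) [Field k] [Algebra k A] [Module k Y] [IsScalarTower k A Y] (P : Type u)
    [AddCommGroup P] [Module A P] (y : Y) : (P →ₗ[A] A) →ₗ[k] (P →ₗ[A] Y) where
  toFun f := LinearMap.toSpanSingleton A Y y ∘ₗ f
  map_add' f g := by ext; simp [add_smul]
  map_smul' c f := by ext; simp

theorem homSMulRight_apply (y : Y) (f : P →ₗ[A] A) (x : P) : homSMulRight k P y f x = f x • y :=
  rfl

/-- A linear form on `Hom_A(P, Y)` that vanishes on the image of `Hom_A(Q, Y)` gives a
homomorphism from `Y` to the dual of the cokernel of `Hom_A(Q, A) → Hom_A(P, A)`. -/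
def homToRightDual (d : P →ₗ[A] Q) (l : Module.Dual k (P →ₗ[A] Y))
    (hl : ∀ g : Q →ₗ[A] Y, l (g ∘ₗ d) = 0) :
    Y →ₗ[A] RightDual k ((P →ₗ[A] A) ⧸ LinearMap.range (dualMapRight A d)) where
  toFun y := (RightDual.toDual k _).symm <|
    ((LinearMap.range (dualMapRight A d)).restrictScalars k).liftQ (l ∘ₗ homSMulRight k P y) (by
      rintro _ ⟨g, rfl⟩
      exact hl (homSMulRight k Q y g)) ∘ₗ
    (Submodule.Quotient.restrictScalarsEquiv k (LinearMap.range (dualMapRight A d))).symm.toLinearMap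
  map_add' y z := RightDual.ext_toDual k _ fun x => by
    obtain ⟨f, rfl⟩ := Submodule.Quotient.mk_surjective _ x
    have : homSMulRight k P (y + z) f = homSMulRight k P y f + homSMulRight k P z f := by
      ext; simp [homSMulRight_apply]
    exact (congrArg l this).trans (map_add l _ _)
  map_smul' a y := RightDual.ext_toDual k _ fun x => by
    obtain ⟨f, rfl⟩ := Submodule.Quotient.mk_surjective _ x
    -- Linearity over `A` reduces to `f x • (a • y) = (f x * a) • y`.
    refine congrArg l (LinearMap.ext fun x => ?_)
    exact smul_smul _ _ _

/-- Every homomorphism out of a finitely generated projective module `P` is a sum of maps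
`x ↦ f x • y` with `f : P → A`. -/
theorem exists_sum_homSMulRight [Module.Projective A P] [Module.Finite A P] (g : P →ₗ[A] Y) :
    ∃ (n : ℕ) (f : Fin n → (P →ₗ[A] A)) (y : Fin n → Y), g = ∑ i, homSMulRight k P (y i) (f i) := by
  obtain ⟨n, p, hp⟩ := Module.Finite.exists_fin' A P
  -- A splitting of `p` gives a dual basis of `P`: the coordinates of `s` and the images of the unit
  -- vectors.
  obtain ⟨s, hs⟩ := Module.projective_lifting_property p LinearMap.id hp
  refine ⟨n, fun i => LinearMap.proj i ∘ₗ s, fun i => g (p (Pi.single i 1)), ?_⟩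
  ext x
  have h : x = ∑ i, s x i • p (Pi.single i 1) := by
    conv_lhs => rw [← LinearMap.id_apply (R := A) x, ← hs, LinearMap.comp_apply,
      pi_eq_sum_univ' (s x), map_sum]
    simp
  conv_lhs => rw [h, map_sum]
  simp [homSMulRight_apply]

theorem eq_zero_of_homSMulRight [Module.Projective A P] [Module.Finite A P]
    (l : Module.Dual k (P →ₗ[A] Y)) (hl : ∀ y f, l (homSMulRight k P y f) = 0) : l = 0 := by
  ext g
  obtain ⟨n, f, y, rfl⟩ := exists_sum_homSMulRight (k := k) g
  simp [hl]

theorem finite_linearMap [Module.Finite k A] [Module.Finite A P] [Module.Finite A Y] :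
    Module.Finite k (P →ₗ[A] Y) := by
  let := Module.restrictScalars k A P
  have := IsScalarTower.restrictScalars k A P
  have : Module.Finite k P := Module.Finite.trans A P
  have : Module.Finite k Y := Module.Finite.trans A Y
  exact Module.Finite.of_injective (LinearMap.restrictScalarsₗ k A P Y k)
    (LinearMap.restrictScalars_injective k)

end HomToRightDual

/-! ### The syzygy sequence in `mod A` -/

section Syzygy

variable {A : Type u} [Ring A] [IsArtinianRing A]

instance projective_of_module_projective (P : FGModuleCat.{u} A) [Module.Projective A P] :
    Projective P where
  factors {E X} f e _ := by
    have he : Function.Surjective e.hom.hom :=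
      (ModuleCat.epi_iff_surjective _).1
        (inferInstanceAs (Epi ((forget₂ (FGModuleCat.{u} A) (ModuleCat.{u} A)).map e)))
    obtain ⟨h, hh⟩ := Module.projective_lifting_property e.hom.hom f.hom.hom he
    exact ⟨FGModuleCat.ofHom h, FGModuleCat.hom_ext hh⟩

/-- The short complex `0 → Ω M → P(M) → M → 0`. -/
def syzygyShortComplex (M : FGModuleCat.{u} A) : ShortComplex (FGModuleCat.{u} A) where
  X₁ := syzygy M
  X₂ := projCover M
  X₃ := M
  f := FGModuleCat.ofHom (LinearMap.ker (projCoverMap M)).subtype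
  g := FGModuleCat.ofHom (projCoverMap M)
  zero := by ext x; exact x.2

theorem shortExact_syzygyShortComplex (M : FGModuleCat.{u} A) :
    (syzygyShortComplex M).ShortExact := by
  let F := forget₂ (FGModuleCat.{u} A) (ModuleCat.{u} A)
  refine
    { exact := ?_
      mono_f := F.mono_of_mono_map ((ModuleCat.mono_iff_injective _).2 Subtype.val_injective)
      epi_g := F.epi_of_epi_map ((ModuleCat.epi_iff_surjective _).2
        (isProjectiveCover_projCoverMap M).surjective) }
  rw [← ShortComplex.exact_map_iff_of_faithful _ F]
  exact (ShortComplex.moduleCat_exact_iff _).2 fun x hx => ⟨⟨x, hx⟩, rfl⟩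

end Syzygy

/-! ### The Auslander–Reiten inequality -/

section Inequality

open scoped ModuleCat

variable (k : Type u) [Field k] {A : Type u} [Ring A] [Algebra k A]

/-- Morphisms of finitely generated modules are linear maps. -/
def homEquivLinearMap (M N : FGModuleCat.{u} A) : (M ⟶ N) ≃ₗ[k] (M →ₗ[A] N) :=
  InducedCategory.homLinearEquiv.trans ModuleCat.homLinearEquiv

variable [FiniteDimensional k A]

instance finite_hom (M N : FGModuleCat.{u} A) : Module.Finite k (M ⟶ N) :=
  have := finite_linearMap (k := k) (A := A) (P := M) (Y := N)
  Module.Finite.equiv (homEquivLinearMap k M N).symm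

variable [IsArtinianRing A]

instance finite_rightDual_transpose (M : FGModuleCat.{u} A) :
    Module.Finite A (RightDual k (Transpose M)) :=
  have : Module.Finite k (projCover (syzygy M) →ₗ[A] A) := finite_hom_self A k _
  RightDual.finite A k _

/-- The linear forms on `Hom(P₁, Y)` vanishing on the image of `Hom(P₀, Y)` map to
`Hom(Y, τ M)`, for the minimal projective presentation `P₁ → P₀ → M → 0`. -/
def dualAnnihilatorToHom (M Y : FGModuleCat.{u} A) :
    (LinearMap.range (Linear.leftComp k Y
      (FGModuleCat.ofHom (minPresentationMap M)))).dualAnnihilator →ₗ[k]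
      (Y ⟶ arTranslate A k M) where
  toFun l := FGModuleCat.ofHom (homToRightDual (minPresentationMap M)
    (l.1 ∘ₗ (homEquivLinearMap k (projCover (syzygy M)) Y).symm.toLinearMap) fun g =>
      (Submodule.mem_dualAnnihilator _).1 l.2 _ ⟨FGModuleCat.ofHom g, rfl⟩)
  map_add' l m := FGModuleCat.hom_ext <| LinearMap.ext fun y => RightDual.ext_toDual k _ fun x => by
    obtain ⟨f, rfl⟩ := Submodule.Quotient.mk_surjective _ x
    rfl
  map_smul' c l := FGModuleCat.hom_ext <| LinearMap.ext fun y => RightDual.ext_toDual k _ fun x => by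
    obtain ⟨f, rfl⟩ := Submodule.Quotient.mk_surjective _ x
    -- On `τM` a scalar acts through `A`, that is by right multiplication on `f`; centrality of `k`
    -- in `A` turns this into the usual scaling.
    have h : MulOpposite.op (algebraMap k A c) • f = c • f := by
      ext p
      exact (Algebra.commutes c (f p)).symm.trans (Algebra.smul_def c (f p)).symm
    let l' : Module.Dual k (projCover (syzygy M) →ₗ[A] Y) :=
      l.1 ∘ₗ (homEquivLinearMap k (projCover (syzygy M)) Y).symm.toLinearMap
    change c • l' (homSMulRight k (projCover (syzygy M)) y f) =
      l' (homSMulRight k (projCover (syzygy M)) y (MulOpposite.op (algebraMap k A c) • f))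
    rw [h, map_smul, map_smul, smul_eq_mul]

/-- If the induced map is zero, the form vanishes on all `f(-) y`, which span as `P₁` is finitely
generated projective. -/
theorem dualAnnihilatorToHom_injective (M Y : FGModuleCat.{u} A) :
    Function.Injective (dualAnnihilatorToHom k M Y) := by
  rw [injective_iff_map_eq_zero]
  intro l hl
  have := (isProjectiveCover_projCoverMap (syzygy M)).projective
  have h := eq_zero_of_homSMulRight
    (l.1 ∘ₗ (homEquivLinearMap k (projCover (syzygy M)) Y).symm.toLinearMap) fun y f => by
      have h' := congrArg (fun φ : Y ⟶ arTranslate A k M =>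
        RightDual.toDual k (Transpose M) (φ.hom.hom y) (Submodule.Quotient.mk f)) hl
      exact h'
  ext g
  exact LinearMap.congr_fun h (homEquivLinearMap k _ _ g)

/-- `dim Ext¹(M, Y) ≤ dim Hom(Y, τ M)`. -/
theorem finrank_ext_one_le [HasExt.{w} (FGModuleCat.{u} A)] (M Y : FGModuleCat.{u} A) :
    Module.Finite k (Abelian.Ext.{w} M Y 1) ∧
      Module.finrank k (Abelian.Ext.{w} M Y 1) ≤ Module.finrank k (Y ⟶ arTranslate A k M) := by
  have hS := shortExact_syzygyShortComplex M
  have : Module.Projective A (projCover M) := (isProjectiveCover_projCoverMap M).projective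
  have : Projective (syzygyShortComplex M).X₂ := inferInstanceAs (Projective (projCover M))
  -- The connecting map of the syzygy sequence, surjective because `Ext¹(P₀, Y) = 0`.
  let s : (syzygy M ⟶ Y) →ₗ[k] Abelian.Ext.{w} M Y 1 :=
    hS.extClass.precompOfLinear k Y (add_zero 1) ∘ₗ Abelian.Ext.linearEquiv₀.symm.toLinearMap
  have hs : Function.Surjective s := by
    intro e
    obtain ⟨x, hx⟩ := Abelian.Ext.contravariant_sequence_exact₃ hS Y e
      (Abelian.Ext.eq_zero_of_projective _) (add_zero 1)
    refine ⟨Abelian.Ext.linearEquiv₀ (R := k) x, ?_⟩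
    change hS.extClass.comp
      (Abelian.Ext.linearEquiv₀.symm (Abelian.Ext.linearEquiv₀ (R := k) x)) (add_zero 1) = e
    rw [LinearEquiv.symm_apply_apply, hx]
  refine finrank_le_of_dual s
    (Linear.leftComp k Y (syzygyShortComplex M).f)
    (Linear.leftComp k Y (FGModuleCat.ofHom (projCoverMap (syzygy M)))) hs ?_ ?_
    (dualAnnihilatorToHom k M Y) (dualAnnihilatorToHom_injective k M Y)
  · ext g
    change hS.extClass.comp (Abelian.Ext.mk₀ ((syzygyShortComplex M).f ≫ g))
      (add_zero 1) = 0
    rw [← Abelian.Ext.mk₀_comp_mk₀, hS.extClass_comp_assoc]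
  · intro f g hfg
    refine FGModuleCat.hom_ext (LinearMap.ext fun x => ?_)
    obtain ⟨p, rfl⟩ := (isProjectiveCover_projCoverMap (syzygy M)).surjective x
    exact congrArg (fun h : projCover (syzygy M) ⟶ Y => h.hom.hom p) hfg

end Inequality

theorem extSpectralRadius_ext_le (k : Type u) [Field k] {A : Type u} [Ring A] [Algebra k A]
    [FiniteDimensional k A] [IsArtinianRing A] {n : ℕ} (X : Fin n → FGModuleCat.{u} A) :
    extSpectralRadius ((extAssignment k (FGModuleCat.{u} A) 1).adjacency X) ≤
      extSpectralRadius ((homAssignment k (arTranslate A k)).adjacency X) := by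
  -- The same Ext groups as in `extAssignment`: `max (u + 1) u` is `u + 1`.
  have : HasExt.{u + 1} (FGModuleCat.{u} A) := HasExt.standard _
  have h := fun i j => finrank_ext_one_le.{u + 1} k (X i) (X j)
  have h₁ : (extAssignment k (FGModuleCat.{u} A) 1).adjacency X = Matrix.of fun i j =>
      ((Module.finrank k (Abelian.Ext.{u + 1} (X i) (X j) 1) : ℝ) : EReal) := by
    ext i j
    have := (h i j).1
    exact extDim_eq_finrank k (Abelian.Ext.{u + 1} (X i) (X j) 1)
  have h₂ : (homAssignment k (arTranslate A k)).adjacency X = Matrix.of fun i j =>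
      ((Module.finrank k (X i ⟶ arTranslate A k (X j)) : ℝ) : EReal) := by
    ext i j
    exact extDim_eq_finrank k (X i ⟶ arTranslate A k (X j))
  let b : Matrix (Fin n) (Fin n) ℝ :=
    Matrix.of fun i j => (Module.finrank k (X i ⟶ arTranslate A k (X j)) : ℝ)
  rw [h₁, h₂]
  refine (extSpectralRadius_coe (Matrix.of fun i j =>
    (Module.finrank k (Abelian.Ext.{u + 1} (X i) (X j) 1) : ℝ))).trans_le
      (le_of_le_of_eq ?_ (extSpectralRadius_coe b).symm)
  -- The bound on the entry `(i, j)` is `dim Hom(X j, τ (X i))`, the entry `(j, i)` of `b`.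
  rw [← spectralRadius_transpose (b.map _), ← Matrix.transpose_map]
  refine spectralRadius_mono (fun i j => Nat.cast_nonneg _) fun i j => ?_
  exact Nat.cast_le.2 (h i j).2

end FrobeniusPerron

end

theorem mainTheorem5 (k : Type u) [Field k] [IsAlgClosed k] (A : Type u) [Ring A] [Algebra k A]
    [FiniteDimensional k A] :
    FrobeniusPerron.fpdExt k A 1 ≤ FrobeniusPerron.fpdTau k A := by
  have : IsArtinianRing A := isArtinian_of_tower k inferInstance
  exact iSup_mono fun n => iSup_mono fun _ => iSup_mono fun X => iSup_mono fun _ =>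
    FrobeniusPerron.extSpectralRadius_ext_le k X
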